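/- All rings are associative with identity and all modules are unital. Let $R$ be a ring. A right $R$-module $M$ is called \emph{Ding projective} if there is an exact sequence $\cdots \to P_1 \to P_0 \to P^0 \to P^1 \to \cdots$ of projective right $R$-modules with $M \cong \ker(P^0 \to P^1)$ which remains exact after applying $\operatorname{Hom}_R(-,F)$ for every flat right $R$-module $F$. The ring $R$ is \emph{right perfect} if every right $R$-module has a projective cover, and \emph{left coherent} if every finitely generated left ideal of $R$ is finitely presented. 1. If the class of Ding projective right $R$-modules is closed under direct limits (colimits over directed sets), then $R$ is right perfect. 2. If $R$ is left coherent and the class of Ding projective right $R$-modules is closed under arbitrary direct products, then $R$ is right perfect. -/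

import Mathlib

open scoped TensorProduct MulOpposite

universe u

/-! Right modules over a ring `R` are modules over `Rᵐᵒᵖ`: the right action of `r` on `m` is
`MulOpposite.op r • m`. Left modules over `R` are `R`-modules. -/

/-- The subgroup of `M ⊗ N` (tensor product of abelian groups) generated by all elements
`(m r) ⊗ n - m ⊗ (r n)`. -/
def balancingRelations (R : Type u) [Ring R] (M N : Type u) [AddCommGroup M] [Module Rᵐᵒᵖ M]
    [AddCommGroup N] [Module R N] : AddSubgroup (M ⊗[ℤ] N) :=
  AddSubgroup.closure {z | ∃ (m : M) (r : R) (n : N),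
    z = (MulOpposite.op r • m) ⊗ₜ[ℤ] n - m ⊗ₜ[ℤ] (r • n)}

/-- The tensor product `M ⊗_R N` of a right `R`-module `M` and a left `R`-module `N`. -/
abbrev BalancedTensor (R : Type u) [Ring R] (M N : Type u) [AddCommGroup M] [Module Rᵐᵒᵖ M]
    [AddCommGroup N] [Module R N] : Type u :=
  (M ⊗[ℤ] N) ⧸ balancingRelations R M N

theorem balancingRelations_le_comap {R : Type u} [Ring R] (M : Type u) [AddCommGroup M]
    [Module Rᵐᵒᵖ M] {N N' : Type u} [AddCommGroup N] [Module R N] [AddCommGroup N'] [Module R N']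
    (f : N →ₗ[R] N') :
    balancingRelations R M N ≤
      (balancingRelations R M N').comap
        (f.toAddMonoidHom.toIntLinearMap.lTensor M).toAddMonoidHom := by
  refine (AddSubgroup.closure_le _).2 ?_
  rintro _ ⟨m, r, n, rfl⟩
  refine AddSubgroup.subset_closure ⟨m, r, f n, ?_⟩
  simp

/-- The homomorphism `M ⊗_R f : M ⊗_R N → M ⊗_R N'`, `m ⊗ n ↦ m ⊗ f n`. -/
def BalancedTensor.map {R : Type u} [Ring R] (M : Type u) [AddCommGroup M]
    [Module Rᵐᵒᵖ M] {N N' : Type u} [AddCommGroup N] [Module R N] [AddCommGroup N'] [Module R N']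
    (f : N →ₗ[R] N') : BalancedTensor R M N →+ BalancedTensor R M N' :=
  QuotientAddGroup.map _ _ (f.toAddMonoidHom.toIntLinearMap.lTensor M).toAddMonoidHom
    (balancingRelations_le_comap M f)

/-- A right `R`-module `M` is flat if `M ⊗_R -` preserves injectivity of homomorphisms of left
`R`-modules. -/
def IsFlatRightModule (R : Type u) [Ring R] (M : Type u) [AddCommGroup M] [Module Rᵐᵒᵖ M] :
    Prop :=
  ∀ (N N' : Type u) [AddCommGroup N] [Module R N] [AddCommGroup N'] [Module R N']
    (f : N →ₗ[R] N'), Function.Injective f → Function.Injective (BalancedTensor.map M f)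

/-- A right `R`-module `M` is Ding projective if it is (isomorphic to) the kernel `ker (P⁰ → P¹)`
in an exact sequence `⋯ → P⁻¹ → P⁰ → P¹ → ⋯` of projective right `R`-modules which stays exact
under `Hom_R(-, F)` for every flat right `R`-module `F`. -/
def IsDingProjective (R : Type u) [Ring R] (M : Type u) [AddCommGroup M] [Module Rᵐᵒᵖ M] :
    Prop :=
  ∃ (P : ℤ → Type u) (_ : ∀ n, AddCommGroup (P n)) (_ : ∀ n, Module Rᵐᵒᵖ (P n))
    (d : ∀ n, P n →ₗ[Rᵐᵒᵖ] P (n + 1)),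
    (∀ n, Module.Projective Rᵐᵒᵖ (P n)) ∧
    (∀ n, Function.Exact (d n) (d (n + 1))) ∧
    (∀ (F : Type u) [AddCommGroup F] [Module Rᵐᵒᵖ F], IsFlatRightModule R F →
      ∀ n, Function.Exact
        (fun g : P (n + 1 + 1) →ₗ[Rᵐᵒᵖ] F => g ∘ₗ d (n + 1))
        (fun g : P (n + 1) →ₗ[Rᵐᵒᵖ] F => g ∘ₗ d n)) ∧
    Nonempty (M ≃ₗ[Rᵐᵒᵖ] LinearMap.ker (d 0))

/-- The Ding projective right `R`-modules are closed under direct limits, i.e. colimits of systems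
indexed by (nonempty) directed sets. -/
def DingProjectivesClosedUnderDirectLimits (R : Type u) [Ring R] : Prop :=
  ∀ (ι : Type u) [Preorder ι] [IsDirectedOrder ι] [Nonempty ι] [DecidableEq ι]
    (G : ι → Type u) [∀ i, AddCommGroup (G i)] [∀ i, Module Rᵐᵒᵖ (G i)]
    (f : ∀ i j, i ≤ j → G i →ₗ[Rᵐᵒᵖ] G j) [DirectedSystem G fun i j h => f i j h],
    (∀ i, IsDingProjective R (G i)) → IsDingProjective R (Module.DirectLimit G f)

/-- The Ding projective right `R`-modules are closed under arbitrary direct products. -/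
def DingProjectivesClosedUnderProducts (R : Type u) [Ring R] : Prop :=
  ∀ (ι : Type u) (G : ι → Type u) [∀ i, AddCommGroup (G i)] [∀ i, Module Rᵐᵒᵖ (G i)],
    (∀ i, IsDingProjective R (G i)) → IsDingProjective R (∀ i, G i)

/-- A ring is left coherent if every finitely generated left ideal is finitely presented. -/
def IsLeftCoherentRing (R : Type u) [Ring R] : Prop :=
  ∀ I : Submodule R R, I.FG → Module.FinitePresentation R I

/-- `p : P → M` is a projective cover: `P` is projective, `p` is surjective, and `ker p` is a
superfluous submodule of `P`. -/
def IsProjectiveCover {S : Type u} [Ring S] {P M : Type u} [AddCommGroup P] [Module S P]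
    [AddCommGroup M] [Module S M] (p : P →ₗ[S] M) : Prop :=
  Module.Projective S P ∧ Function.Surjective p ∧
    ∀ N : Submodule S P, N ⊔ LinearMap.ker p = ⊤ → N = ⊤

/-- A ring is right perfect if every right module has a projective cover. -/
def IsRightPerfectRing (R : Type u) [Ring R] : Prop :=
  ∀ (M : Type u) [AddCommGroup M] [Module Rᵐᵒᵖ M],
    ∃ (P : Type u) (_ : AddCommGroup P) (_ : Module Rᵐᵒᵖ P) (p : P →ₗ[Rᵐᵒᵖ] M),
      IsProjectiveCover p

/-! A flat Ding projective module `M` is projective: it is a syzygy in its complex, and exactness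
under `Hom(-, M)` extends the identity of `M` to the projective term containing it
(`IsDingProjective.projective_of_flat`). Each closure hypothesis thus makes certain flat modules
projective: limits of `R → R → ⋯` in the first case, products `R^I` (flat by left coherence) in the
second.

Projectivity of these modules forces the descending chain condition on principal left ideals of `R`,
by Bass's argument (`exists_mulSeq_dvd_of_projective`) and Chase's (`exists_row_dvd_of_notMem`)
respectively. For `S = Rᵐᵒᵖ` this is `PrincipalRightIdealDCC S`; recall that `a ∣ b` means `bS ⊆
aS`.

Bass's theorem finishes. The chain condition makes the radical `J` of `S` T-nilpotent and `S ⧸ J`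
semisimple. Idempotents then lift modulo `J`, Nakayama's lemma holds for all left modules, and a
projective presentation of `M ⧸ JM` with kernel in the radical lifts to a projective cover of `M`.
-/

/-! ### Balanced tensor products and the equational criterion for flatness. -/

section Flat

variable {R : Type u} [Ring R] {M N N' : Type u} [AddCommGroup M] [Module Rᵐᵒᵖ M]

/-- The biadditive pairing of `M` with finitely supported coefficient functions. -/
noncomputable def finsuppAct (R : Type u) [Ring R] (M N : Type u) [AddCommGroup M]
    [Module Rᵐᵒᵖ M] : M →+ (N →₀ R) →+ (N →₀ M) :=
  AddMonoidHom.mk' (fun m => Finsupp.mapRange.addMonoidHom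
    (AddMonoidHom.mk' (fun r : R => MulOpposite.op r • m) fun a b => by
      simp [add_smul])) fun a b => by
    ext; simp

theorem finsuppAct_apply (m : M) (h : N →₀ R) (n : N) :
    finsuppAct R M N m h n = MulOpposite.op (h n) • m := rfl

theorem finsuppAct_smul (r : R) (m : M) (h : N →₀ R) :
    finsuppAct R M N (MulOpposite.op r • m) h = finsuppAct R M N m (r • h) := by
  ext n
  simp [finsuppAct_apply, mul_smul]

theorem finsuppAct_single (m : M) (n : N) (r : R) :
    finsuppAct R M N m (Finsupp.single n r) = Finsupp.single n (MulOpposite.op r • m) := by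
  simp [finsuppAct]

theorem finsuppAct_mapDomain (f : N → N') (m : M) (h : N →₀ R) :
    finsuppAct R M N' m (h.mapDomain f) = (finsuppAct R M N m h).mapDomain f := by
  induction h using Finsupp.induction_linear with
  | zero => simp
  | add a b ha hb => simp [Finsupp.mapDomain_add, ha, hb]
  | single n r => simp [finsuppAct_single]

variable [AddCommGroup N] [Module R N] [AddCommGroup N'] [Module R N']

/-- The pure tensor `m ⊗ n` in the balanced tensor product. -/
def BalancedTensor.tmul (R : Type u) [Ring R] {M N : Type u} [AddCommGroup M] [Module Rᵐᵒᵖ M]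
    [AddCommGroup N] [Module R N] (m : M) (n : N) : BalancedTensor R M N :=
  QuotientAddGroup.mk (m ⊗ₜ[ℤ] n)

theorem BalancedTensor.tmul_add (m : M) (n n' : N) :
    tmul R m (n + n') = tmul R m n + tmul R m n' := by
  simp [tmul, TensorProduct.tmul_add]

theorem BalancedTensor.add_tmul (m m' : M) (n : N) :
    tmul R (m + m') n = tmul R m n + tmul R m' n := by
  simp [tmul, TensorProduct.add_tmul]

theorem BalancedTensor.smul_tmul (m : M) (r : R) (n : N) :
    tmul R (MulOpposite.op r • m) n = tmul R m (r • n) := by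
  refine ((QuotientAddGroup.eq_iff_sub_mem).2 ?_)
  exact AddSubgroup.subset_closure ⟨m, r, n, rfl⟩

theorem BalancedTensor.tmul_zero (m : M) : tmul R m (0 : N) = 0 := by
  simp [tmul]

theorem BalancedTensor.map_tmul (f : N →ₗ[R] N') (m : M) (n : N) :
    map M f (tmul R m n) = tmul R m (f n) := rfl

/-- The canonical surjection from formal sums `∑ m ⊗ n` onto the balanced tensor product. -/
noncomputable def BalancedTensor.ofFinsupp (R : Type u) [Ring R] (M N : Type u) [AddCommGroup M]
    [Module Rᵐᵒᵖ M] [AddCommGroup N] [Module R N] : (N →₀ M) →+ BalancedTensor R M N :=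
  Finsupp.liftAddHom fun n => AddMonoidHom.mk' (fun m => tmul R m n) fun a b => add_tmul a b n

theorem BalancedTensor.ofFinsupp_single (n : N) (m : M) :
    ofFinsupp R M N (Finsupp.single n m) = tmul R m n := by
  simp only [ofFinsupp, Finsupp.liftAddHom_apply_single, AddMonoidHom.mk'_apply]

theorem BalancedTensor.ofFinsupp_surjective : Function.Surjective (ofFinsupp R M N) := by
  intro z
  obtain ⟨z, rfl⟩ := QuotientAddGroup.mk_surjective z
  induction z using TensorProduct.induction_on with
  | zero => exact ⟨0, by simp⟩
  | tmul m n => exact ⟨Finsupp.single n m, ofFinsupp_single n m⟩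
  | add a b ha hb =>
    obtain ⟨x, hx⟩ := ha
    obtain ⟨y, hy⟩ := hb
    exact ⟨x + y, by simp [hx, hy]⟩

theorem BalancedTensor.map_ofFinsupp (f : N →ₗ[R] N') (z : N →₀ M) :
    map M f (ofFinsupp R M N z) = ofFinsupp R M N' (z.mapDomain f) := by
  induction z using Finsupp.induction_linear with
  | zero => simp
  | add a b ha hb => simp [Finsupp.mapDomain_add, ha, hb]
  | single n m => simp [ofFinsupp_single, map_tmul]

theorem BalancedTensor.ofFinsupp_finsuppAct (m : M) (h : N →₀ R) :
    ofFinsupp R M N (finsuppAct R M N m h) = tmul R m (Finsupp.linearCombination R id h) := by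
  induction h using Finsupp.induction_linear with
  | zero => simp [tmul_zero]
  | add a b ha hb => simp [ha, hb, tmul_add]
  | single n r => simp [finsuppAct_single, ofFinsupp_single, smul_tmul]

/-- The formal sums coming from the relations between elements of `N`. -/
noncomputable def relationSums (R : Type u) [Ring R] (M N : Type u) [AddCommGroup M]
    [Module Rᵐᵒᵖ M] [AddCommGroup N] [Module R N] :
    (LinearMap.ker (Finsupp.linearCombination R (id : N → N)) →₀ M) →+ (N →₀ M) :=
  Finsupp.liftAddHom fun k => (finsuppAct R M N).flip k

theorem finsuppAct_mem_range (m : M) (k : N →₀ R) (hk : Finsupp.linearCombination R id k = 0) :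
    finsuppAct R M N m k ∈ (relationSums R M N).range :=
  ⟨Finsupp.single ⟨k, hk⟩ m, by simp [relationSums]⟩

/-- This is right exactness of the tensor product on the presentation of `N` by all its elements.
The proof builds a map `φ` back from the tensor product to the quotient by relation sums. -/
theorem BalancedTensor.mem_range_of_ofFinsupp_eq_zero (z : N →₀ M) (hz : ofFinsupp R M N z = 0) :
    z ∈ (relationSums R M N).range := by
  let L := (relationSums R M N).range
  let f : M →+ N →+ (N →₀ M) ⧸ L := AddMonoidHom.mk' (fun m => AddMonoidHom.mk'
      (fun n => QuotientAddGroup.mk (Finsupp.single n m)) fun a b => by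
        rw [← QuotientAddGroup.mk_add]
        refine QuotientAddGroup.eq_iff_sub_mem.2 ?_
        have := finsuppAct_mem_range (R := R) m
          (Finsupp.single (a + b) 1 - (Finsupp.single a 1 + Finsupp.single b 1)) (by simp)
        simpa only [map_sub, map_add, finsuppAct_single, MulOpposite.op_one, one_smul] using this)
      fun a b => by ext n; simp
  let g : M ⊗[ℤ] N →+ (N →₀ M) ⧸ L := TensorProduct.liftAddHom f fun r m n => by
    simp [map_zsmul]
  let φ : BalancedTensor R M N →+ (N →₀ M) ⧸ L := QuotientAddGroup.lift _ g <| by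
    refine (AddSubgroup.closure_le _).2 ?_
    rintro _ ⟨m, r, n, rfl⟩
    change g _ = 0
    rw [map_sub, sub_eq_zero]
    refine QuotientAddGroup.eq_iff_sub_mem.2 ?_
    have := finsuppAct_mem_range (R := R) m
      (Finsupp.single n r - Finsupp.single (r • n) 1) (by simp)
    simpa only [map_sub, map_add, finsuppAct_single, MulOpposite.op_one, one_smul] using this
  have key : φ.comp (ofFinsupp R M N) = QuotientAddGroup.mk' L := by
    ext n m
    simp only [AddMonoidHom.comp_apply, Finsupp.singleAddHom_apply, ofFinsupp_single]
    rfl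
  have := DFunLike.congr_fun key z
  rw [AddMonoidHom.comp_apply, hz, map_zero] at this
  exact (QuotientAddGroup.eq_zero_iff z).1 this.symm

theorem BalancedTensor.exists_relations_of_ofFinsupp_eq_zero (z : N →₀ M)
    (hz : ofFinsupp R M N z = 0) :
    ∃ (T : Type u) (_ : Fintype T) (k : T → N →₀ R) (l : T → M),
      (∀ t, Finsupp.linearCombination R id (k t) = 0) ∧
        z = ∑ t, finsuppAct R M N (l t) (k t) := by
  obtain ⟨w, rfl⟩ := mem_range_of_ofFinsupp_eq_zero z hz
  refine ⟨w.support, inferInstance, fun t => t.1.1, fun t => w t, fun t => t.1.2, ?_⟩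
  rw [Finset.sum_coe_sort w.support fun k => finsuppAct R M N (w k) k.1]
  rfl

/-- The equational condition for flatness: finite systems of linear relations are consequences
of linear relations over the ring. -/
def RelationsTrivial (R : Type u) [Ring R] (M : Type u) [AddCommGroup M] [Module Rᵐᵒᵖ M] :
    Prop :=
  ∀ (T E : Type u) [Fintype T] [Fintype E] (A : T → E → R) (l : T → M),
    (∀ e, ∑ t, MulOpposite.op (A t e) • l t = 0) →
    ∃ (U : Type u) (_ : Fintype U) (q : U → M) (b : U → T → R),
      (∀ t, l t = ∑ v, MulOpposite.op (b v t) • q v) ∧ ∀ v e, ∑ t, b v t * A t e = 0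

/-- The image of `z` is a combination of relations `k t` in `N'`. Trivializing the equations at
coordinates outside the range of `f` replaces the `k t` by combinations `h v` supported in that
range, which pull back to relations in `N`. -/
theorem RelationsTrivial.isFlatRightModule (H : RelationsTrivial R M) :
    IsFlatRightModule R M := by
  classical
  intro N N' _ _ _ _ f hf
  refine (injective_iff_map_eq_zero _).2 fun z hz => ?_
  obtain ⟨z, rfl⟩ := BalancedTensor.ofFinsupp_surjective z
  rw [BalancedTensor.map_ofFinsupp] at hz
  obtain ⟨T, _, k, l, hk, hkl⟩ := BalancedTensor.exists_relations_of_ofFinsupp_eq_zero _ hz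
  let E : Finset N' := (Finset.univ.biUnion fun t => (k t).support).filter (· ∉ Set.range f)
  obtain ⟨U, _, q, b, hl, hb⟩ := H T E (fun t e => k t e) l <| by
    rintro ⟨e, he⟩
    have h1 := Finsupp.mapDomain_of_notMem_range (f := f) z e (Finset.mem_filter.1 he).2
    rw [hkl, Finsupp.finsetSum_apply] at h1
    exact h1
  let h : U → N' →₀ R := fun v => ∑ t, b v t • k t
  have hsupp : ∀ v, ((h v).support : Set N') ⊆ Set.range f := by
    intro v e he
    by_contra hr
    refine (Finsupp.mem_support_iff.1 he) ?_
    simp only [h, Finsupp.finsetSum_apply, Finsupp.smul_apply, smul_eq_mul]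
    by_cases heE : e ∈ E
    · exact hb v ⟨e, heE⟩
    · refine Finset.sum_eq_zero fun t _ => ?_
      have : k t e = 0 := by
        by_contra h0
        exact heE (Finset.mem_filter.2 ⟨Finset.mem_biUnion.2
          ⟨t, Finset.mem_univ _, Finsupp.mem_support_iff.2 h0⟩, hr⟩)
      rw [this, mul_zero]
  let h' : U → N →₀ R := fun v => (h v).comapDomain f hf.injOn
  have hh' : ∀ v, (h' v).mapDomain f = h v := fun v =>
    Finsupp.mapDomain_comapDomain f hf _ (hsupp v)
  have hz' : z = ∑ v, finsuppAct R M N (q v) (h' v) := by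
    refine Finsupp.mapDomain_injective hf ?_
    rw [hkl, Finsupp.mapDomain_finsetSum]
    simp_rw [← finsuppAct_mapDomain, hh', h, map_sum, hl]
    rw [Finset.sum_comm]
    refine Finset.sum_congr rfl fun t _ => ?_
    rw [map_sum, AddMonoidHom.finsetSum_apply]
    exact Finset.sum_congr rfl fun v _ => finsuppAct_smul _ _ _
  rw [hz', map_sum]
  refine Finset.sum_eq_zero fun v _ => ?_
  rw [BalancedTensor.ofFinsupp_finsuppAct]
  have : Finsupp.linearCombination R id (h' v) = 0 := by
    apply hf
    have h2 : Finsupp.linearCombination R id ((h' v).mapDomain f) =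
        f (Finsupp.linearCombination R id (h' v)) := by
      rw [Finsupp.linearCombination_mapDomain]
      exact (Finsupp.apply_linearCombination R f id (h' v)).symm
    rw [← h2, hh', map_zero, map_sum]
    exact Finset.sum_eq_zero fun t _ => by rw [map_smul, hk, smul_zero]
  rw [this, BalancedTensor.tmul_zero]

end Flat

/-! ### Flatness of products over a coherent ring and of direct limits of `R`. -/

section FlatExamples

variable {R : Type u} [Ring R]

/-- The intersection is the kernel of `K → φ(K)`, a map from a finitely generated module onto a
finitely presented left ideal. -/
theorem IsLeftCoherentRing.fg_inf_ker (hR : IsLeftCoherentRing R) {V : Type u} [AddCommGroup V]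
    [Module R V] (K : Submodule R V) (hK : K.FG) (φ : V →ₗ[R] R) : (K ⊓ LinearMap.ker φ).FG := by
  let φ' : K →ₗ[R] K.map φ := (φ ∘ₗ K.subtype).codRestrict _ fun x => ⟨x, x.2, rfl⟩
  have hsurj : Function.Surjective φ' := by
    rintro ⟨_, x, hx, rfl⟩
    exact ⟨⟨x, hx⟩, rfl⟩
  have : Module.FinitePresentation R (K.map φ) := hR _ (hK.map φ)
  have : Module.Finite R K := Module.Finite.iff_fg.2 hK
  have h1 := (Module.FinitePresentation.fg_ker φ' hsurj).map K.subtype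
  convert h1 using 1
  ext x
  simp only [Submodule.mem_inf, LinearMap.mem_ker, Submodule.mem_map, Submodule.subtype_apply,
    Subtype.exists, exists_and_right, exists_eq_right]
  exact ⟨fun ⟨hx, h⟩ => ⟨hx, Subtype.ext h⟩, fun ⟨hx, h⟩ => ⟨hx, congrArg Subtype.val h⟩⟩

theorem IsLeftCoherentRing.fg_iInf_ker (hR : IsLeftCoherentRing R) {V E : Type u} [AddCommGroup V]
    [Module R V] [Module.Finite R V] [Finite E] (φ : E → V →ₗ[R] R) :
    (⨅ e, LinearMap.ker (φ e)).FG := by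
  classical
  have := Fintype.ofFinite E
  have h : ∀ s : Finset E, (⨅ e ∈ s, LinearMap.ker (φ e)).FG := by
    intro s
    induction s using Finset.induction_on with
    | empty => simpa using Module.Finite.fg_top
    | insert e s _ ih =>
      rw [Finset.iInf_insert, inf_comm]
      exact hR.fg_inf_ker _ ih _
  simpa using h Finset.univ

/-- Every coordinate of `l` solves the same finite linear system over `R`. By coherence the
solutions have a finite generating set `s`, which serves all coordinates at once. -/
theorem IsLeftCoherentRing.relationsTrivial_pi (hR : IsLeftCoherentRing R) (I : Type u) :
    RelationsTrivial R (I → R) := by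
  intro T E _ _ A l hl
  obtain ⟨s, hs⟩ := hR.fg_iInf_ker fun e : E => Fintype.linearCombination R fun t : T => A t e
  have hmem : ∀ i, (fun t => l t i) ∈ Submodule.span R (s : Set (T → R)) := by
    intro i
    rw [hs]
    refine (Submodule.mem_iInf _).2 fun e => ?_
    simpa [Fintype.linearCombination_apply] using congrFun (hl e) i
  choose c hc using fun i => Submodule.mem_span_finset'.1 (hmem i)
  refine ⟨s, inferInstance, fun v i => c i v, fun v => v.1, fun t => ?_, fun v e => ?_⟩
  · ext i
    simpa using (congrFun (hc i) t).symm
  · have hv : v.1 ∈ Submodule.span R (s : Set (T → R)) := Submodule.subset_span v.2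
    rw [hs] at hv
    simpa [Fintype.linearCombination_apply] using (Submodule.mem_iInf _).1 hv e

theorem relationsTrivial_mulOpposite : RelationsTrivial R Rᵐᵒᵖ := by
  intro T E _ _ A l hl
  refine ⟨PUnit, inferInstance, fun _ => 1, fun _ t => (l t).unop, fun t => by simp,
    fun _ e => ?_⟩
  have := congrArg MulOpposite.unop (hl e)
  simpa [Finset.unop_sum] using this

/-- Finitely many elements and equations already live at one common stage. -/
theorem RelationsTrivial.directLimit {ι : Type u} [Preorder ι] [IsDirectedOrder ι] [Nonempty ι]
    [DecidableEq ι] (G : ι → Type u) [∀ i, AddCommGroup (G i)] [∀ i, Module Rᵐᵒᵖ (G i)]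
    (f : ∀ i j, i ≤ j → G i →ₗ[Rᵐᵒᵖ] G j) [DirectedSystem G fun i j h => f i j h]
    (hG : ∀ i, RelationsTrivial R (G i)) : RelationsTrivial R (Module.DirectLimit G f) := by
  intro T E _ _ A l hl
  choose k x hx using fun t => Module.DirectLimit.exists_of (l t)
  obtain ⟨i, hi⟩ := Finite.exists_le k
  let y : T → G i := fun t => f _ _ (hi t) (x t)
  have hy : ∀ t, Module.DirectLimit.of Rᵐᵒᵖ ι G f i (y t) = l t := fun t => by
    simp [y, Module.DirectLimit.of_f, hx]
  have hz : ∀ e, ∃ j, ∃ hij : i ≤ j, f i j hij (∑ t, MulOpposite.op (A t e) • y t) = 0 := by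
    intro e
    refine Module.DirectLimit.of.zero_exact ?_
    simpa [hy] using hl e
  choose j hij hj using hz
  obtain ⟨m, hm⟩ := Finite.exists_le j
  obtain ⟨m', him', hmm'⟩ := exists_ge_ge i m
  obtain ⟨U, _, q, b, hq, hb⟩ := hG m' T E A (fun t => f i m' him' (y t)) fun e => by
    have h1 := congrArg (f _ m' ((hm e).trans hmm')) (hj e)
    rw [map_zero, DirectedSystem.map_map' f] at h1
    simpa using h1
  refine ⟨U, inferInstance, fun v => Module.DirectLimit.of Rᵐᵒᵖ ι G f m' (q v), b, fun t => ?_, hb⟩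
  rw [← hy t, ← Module.DirectLimit.of_f (hij := him'), hq t]
  simp

end FlatExamples

/-! ### Ding projective modules: projective ones, and flat ones. -/

section Ding

variable {R : Type u} [Ring R] {M : Type u} [AddCommGroup M] [Module Rᵐᵒᵖ M]

theorem isDingProjective_of_projective [Module.Projective Rᵐᵒᵖ M] : IsDingProjective R M := by
  -- The contractible complex with differential `(x, y) ↦ (y, 0)`.
  refine ⟨fun _ => M × M, fun _ => inferInstance, fun _ => inferInstance,
    fun _ => LinearMap.inl Rᵐᵒᵖ M M ∘ₗ LinearMap.snd Rᵐᵒᵖ M M, fun _ => inferInstance,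
    fun _ => ?_, fun F _ _ _ _ => ?_, ⟨?_⟩⟩
  · rintro ⟨x, y⟩
    constructor
    · intro h
      refine ⟨(0, x), ?_⟩
      have : y = 0 := by simpa using h
      simp [this]
    · rintro ⟨w, hw⟩
      have : y = 0 := by simpa using (congrArg Prod.snd hw).symm
      simp [this]
  · intro g
    constructor
    · intro h
      refine ⟨g ∘ₗ LinearMap.inr Rᵐᵒᵖ M M ∘ₗ LinearMap.fst Rᵐᵒᵖ M M, ?_⟩
      refine LinearMap.ext fun ⟨x, y⟩ => ?_
      have h1 : g (x, 0) = 0 := by simpa using DFunLike.congr_fun h (0, x)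
      have h2 : g (x, y) = g (x, 0) + g (0, y) := by rw [← map_add]; simp
      simp [h2, h1]
    · rintro ⟨w, rfl⟩
      refine LinearMap.ext fun _ => ?_
      exact map_zero w
  · refine LinearEquiv.ofBijective
      ((LinearMap.inl Rᵐᵒᵖ M M).codRestrict _ fun m => by simp) ⟨?_, ?_⟩
    · intro a b h
      exact congrArg (fun z => z.1.1) h
    · rintro ⟨⟨x, y⟩, h⟩
      have : y = 0 := by simpa using h
      exact ⟨x, Subtype.ext (Prod.ext rfl this.symm)⟩

/-- A flat module which is a syzygy in an exact complex of projectives, exact under `Hom(-, F)` for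
flat `F`, is projective: the identity extends along the inclusion. -/
theorem projective_of_flat_of_ker {P₀ P₁ P₂ P₃ : Type u} [AddCommGroup P₀] [Module Rᵐᵒᵖ P₀]
    [AddCommGroup P₁] [Module Rᵐᵒᵖ P₁] [AddCommGroup P₂] [Module Rᵐᵒᵖ P₂]
    [AddCommGroup P₃] [Module Rᵐᵒᵖ P₃] [Module.Projective Rᵐᵒᵖ P₂]
    (d₀ : P₀ →ₗ[Rᵐᵒᵖ] P₁) (d₁ : P₁ →ₗ[Rᵐᵒᵖ] P₂) (d₂ : P₂ →ₗ[Rᵐᵒᵖ] P₃)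
    (h₀ : Function.Exact d₀ d₁) (h₁ : Function.Exact d₁ d₂)
    (H : Function.Exact (fun g : P₂ →ₗ[Rᵐᵒᵖ] M => g ∘ₗ d₁) (fun g : P₁ →ₗ[Rᵐᵒᵖ] M => g ∘ₗ d₀))
    (e : M ≃ₗ[Rᵐᵒᵖ] LinearMap.ker d₂) : Module.Projective Rᵐᵒᵖ M := by
  let d₁' : P₁ →ₗ[Rᵐᵒᵖ] LinearMap.ker d₂ := d₁.codRestrict _ fun x => (h₁ _).2 ⟨x, rfl⟩
  -- The map `P₁ → ker d₂ ≅ M` kills the image of `d₀`, so it factors through `d₁` by some `g`,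
  -- which is `e.symm` on `ker d₂ = im d₁`.
  obtain ⟨g, hg⟩ := (H (e.symm.toLinearMap ∘ₗ d₁')).1 <| by
    refine LinearMap.ext fun x => ?_
    have : d₁' (d₀ x) = 0 := Subtype.ext ((h₀ _).2 ⟨x, rfl⟩)
    simp [this]
  refine Module.Projective.of_split ((LinearMap.ker d₂).subtype ∘ₗ e.toLinearMap) g ?_
  refine LinearMap.ext fun m => ?_
  obtain ⟨x, hx⟩ := (h₁ (e m)).1 (e m).2
  have h1 : d₁' x = e m := Subtype.ext hx
  have h2 : g (d₁ x) = e.symm (d₁' x) := DFunLike.congr_fun hg x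
  change g (e m) = m
  rw [← hx, h2, h1, e.symm_apply_apply]

theorem IsDingProjective.projective_of_flat (hM : IsDingProjective R M)
    (hF : IsFlatRightModule R M) : Module.Projective Rᵐᵒᵖ M := by
  obtain ⟨P, _, _, d, hP, hd, hH, ⟨e⟩⟩ := hM
  -- The integer `-2 + 1 + 1` reduces to `0`, so `e` fits `d (-2 + 1 + 1)`.
  have := hP (-2 + 1 + 1)
  exact projective_of_flat_of_ker (d (-2)) (d (-2 + 1)) (d (-2 + 1 + 1)) (hd (-2)) (hd (-2 + 1))
    (hH M hF (-2)) e

end Ding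

/-! ### Chains of principal right ideals and Bass's argument. -/

section Chain

/-- The descending chain condition for principal right ideals. -/
def PrincipalRightIdealDCC (S : Type u) [Monoid S] : Prop :=
  ∀ p : ℕ → S, (∀ n, p n ∣ p (n + 1)) → ∃ n, ∀ m, p m ∣ p n

/-- The product `a i * a (i + 1) * ⋯ * a (i + k - 1)`. -/
def mulSeq {S : Type u} [Monoid S] (a : ℕ → S) (i : ℕ) : ℕ → S
  | 0 => 1
  | k + 1 => mulSeq a i k * a (i + k)

theorem mulSeq_add {S : Type u} [Monoid S] (a : ℕ → S) (i k l : ℕ) :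
    mulSeq a i (k + l) = mulSeq a i k * mulSeq a (i + k) l := by
  induction l with
  | zero => simp [mulSeq]
  | succ l ih => simp [mulSeq, ← add_assoc, ih, mul_assoc]

theorem eq_mul_mulSeq {S : Type u} [Monoid S] {a p : ℕ → S} (h : ∀ n, p (n + 1) = p n * a n)
    (i k : ℕ) : p (i + k) = p i * mulSeq a i k := by
  induction k with
  | zero => simp [mulSeq]
  | succ k ih => rw [← add_assoc, h, ih, mulSeq, mul_assoc]

variable {S : Type u} [Ring S]

/-- Bass: if the direct limit of `S → S → S → ⋯`, with maps the right multiplications by `a n`, is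
projective, then the chain of right ideals generated by `a 0 * ⋯ * a (n - 1)` stabilizes. -/
theorem exists_mulSeq_dvd_of_projective (a : ℕ → S) {B : Type u} [AddCommGroup B] [Module S B]
    [Module.Projective S B] (z : ℕ → B) (hz : ∀ n, z n = a n • z (n + 1))
    (hspan : Submodule.span S (Set.range z) = ⊤)
    (hzero : ∀ n x, x • z n = 0 → ∃ k, x * mulSeq a n k = 0) :
    ∃ n, ∀ m, mulSeq a 0 m ∣ mulSeq a 0 n := by
  have hzk : ∀ n k, z n = mulSeq a n k • z (n + k) := by
    intro n k
    induction k with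
    | zero => simp [mulSeq]
    | succ k ih => rw [mulSeq, mul_smul, ← add_assoc, ← hz, ← ih]
  have hsurj : Function.Surjective (Finsupp.linearCombination S z) := by
    rw [← LinearMap.range_eq_top, Finsupp.range_linearCombination, hspan]
  obtain ⟨s, hs⟩ := Module.projective_lifting_property (Finsupp.linearCombination S z)
    LinearMap.id hsurj
  have hs' : ∀ x, Finsupp.linearCombination S z (s x) = x := DFunLike.congr_fun hs
  obtain ⟨N, hN⟩ : ∃ N, ∀ k ∈ (s (z 0)).support, k ≤ N :=
    ⟨(s (z 0)).support.sup id, fun k hk => Finset.le_sup (f := id) hk⟩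
  -- Rewriting the expansion of `z 0` given by the splitting `s` in terms of `z N` alone yields the
  -- coefficient `d`.
  let d : S := ∑ k ∈ (s (z 0)).support, s (z 0) k * mulSeq a k (N - k)
  have hd : d • z N = z 0 := by
    conv_rhs => rw [← hs' (z 0), Finsupp.linearCombination_apply, Finsupp.sum]
    rw [Finset.sum_smul]
    refine Finset.sum_congr rfl fun k hk => ?_
    rw [mul_smul, hzk k (N - k), Nat.add_sub_cancel' (hN k hk)]
  obtain ⟨k, hk⟩ := hzero N (mulSeq a 0 N - d) <| by
    rw [sub_smul, hd, sub_eq_zero]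
    simpa using (hzk 0 N).symm
  refine ⟨N + k, fun m => ?_⟩
  rw [mulSeq_add, zero_add, sub_eq_zero.1 ((sub_mul _ _ _).symm.trans hk)]
  refine Dvd.dvd.mul_right (Finset.dvd_sum fun i _ => Dvd.dvd.mul_right ?_ _) _
  -- Since `z 0 = mulSeq a 0 m • z m`, every coordinate of `s (z 0)` is divisible by `mulSeq a 0 m`.
  refine ⟨s (z m) i, ?_⟩
  conv_lhs => rw [hzk 0 m, map_smul, zero_add]
  rfl

end Chain

/-! ### The chain condition from closure under direct limits. -/

section Bass

variable {R : Type u} [Ring R]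

theorem principalRightIdealDCC_of_directLimits (H : DingProjectivesClosedUnderDirectLimits R) :
    PrincipalRightIdealDCC Rᵐᵒᵖ := by
  intro p hp
  choose a ha using hp
  let G : ULift.{u} ℕ → Type u := fun _ => Rᵐᵒᵖ
  let f : ∀ i j : ULift.{u} ℕ, i ≤ j → G i →ₗ[Rᵐᵒᵖ] G j := fun i j _ =>
    LinearMap.toSpanSingleton Rᵐᵒᵖ Rᵐᵒᵖ (mulSeq a i.down (j.down - i.down))
  have hf : ∀ i j h (x : Rᵐᵒᵖ), f i j h x = x * mulSeq a i.down (j.down - i.down) :=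
    fun _ _ _ _ => rfl
  have : DirectedSystem G fun i j h => f i j h :=
    { map_self := fun i x => by
        rw [hf i i le_rfl, Nat.sub_self, mulSeq, mul_one]
      map_map := fun k j i hij hjk x => by
        obtain ⟨i⟩ := i
        obtain ⟨j⟩ := j
        obtain ⟨k⟩ := k
        obtain ⟨c, rfl⟩ := Nat.exists_eq_add_of_le (ULift.down_le.2 hij)
        obtain ⟨d, rfl⟩ := Nat.exists_eq_add_of_le (ULift.down_le.2 hjk)
        simp only [hf]
        rw [mul_assoc, Nat.add_sub_cancel_left, Nat.add_sub_cancel_left, add_assoc,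
          Nat.add_sub_cancel_left, mulSeq_add] }
  let B := Module.DirectLimit G f
  have hflat : IsFlatRightModule R B :=
    (RelationsTrivial.directLimit G f fun _ => relationsTrivial_mulOpposite).isFlatRightModule
  have hproj : Module.Projective Rᵐᵒᵖ B :=
    (H _ G f fun i => isDingProjective_of_projective (M := Rᵐᵒᵖ)).projective_of_flat hflat
  let z : ℕ → B := fun n => Module.DirectLimit.of Rᵐᵒᵖ _ G f ⟨n⟩ (1 : Rᵐᵒᵖ)
  have hof : ∀ n (x : Rᵐᵒᵖ), Module.DirectLimit.of Rᵐᵒᵖ _ G f ⟨n⟩ x = x • z n := fun n x => by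
    rw [← map_smul]
    congr 1
    exact (mul_one x).symm
  obtain ⟨n, hn⟩ := exists_mulSeq_dvd_of_projective a z (fun n => by
      have hle : (⟨n⟩ : ULift.{u} ℕ) ≤ ⟨n + 1⟩ := Nat.le_succ n
      have h1 : f ⟨n⟩ ⟨n + 1⟩ hle (1 : Rᵐᵒᵖ) = a n := by
        simp [hf, mulSeq]
      rw [← hof (n + 1), ← h1]
      exact (Module.DirectLimit.of_f (f := f) (hij := hle) (x := (1 : Rᵐᵒᵖ))).symm)
    (by
      refine eq_top_iff.2 fun b _ => ?_
      obtain ⟨⟨n⟩, x, rfl⟩ := Module.DirectLimit.exists_of b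
      rw [hof]
      exact Submodule.smul_mem _ _ (Submodule.subset_span ⟨n, rfl⟩))
    (fun n x hx => by
      rw [← hof] at hx
      obtain ⟨⟨m⟩, hnm, h⟩ := Module.DirectLimit.of.zero_exact hx
      exact ⟨m - n, h⟩)
  refine ⟨n, fun m => ?_⟩
  have h0 : ∀ k, p k = p 0 * mulSeq a 0 k := fun k => by
    simpa using eq_mul_mulSeq ha 0 k
  rw [h0 m, h0 n]
  exact mul_dvd_mul_left _ (hn m)

end Bass

/-! ### The chain condition from closure under products. -/

section Chase

variable {S : Type u} [Ring S]

/-- The function on `ℕ × κ` equal to `v` on the row `n` and zero elsewhere. -/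
def rowFun {κ : Type u} (n : ℕ) (v : κ → S) : ℕ × κ → S := fun c => if c.1 = n then v c.2 else 0

theorem dvd_of_chain {p : ℕ → S} (hp : ∀ n, p n ∣ p (n + 1)) {m n : ℕ} (h : m ≤ n) : p m ∣ p n :=
  Nat.le_induction dvd_rfl (fun k _ ih => ih.trans (hp k)) n h

/-- Chase's lemma on homomorphisms from products to direct sums. -/
theorem exists_row_dvd_of_notMem {κ X : Type u} {p : ℕ → S} (hp : ∀ n, p n ∣ p (n + 1))
    (i : (ℕ × κ → S) →ₗ[S] X →₀ S) :
    ∃ (n : ℕ) (F : Finset X), ∀ (w : κ → S), ∀ x ∉ F, ∀ m, p m ∣ i (rowFun n (p n • w)) x := by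
  classical
  by_contra! hneg
  choose w x hxF m hm using hneg
  -- State `j` is a row `N j` and a finite set `F j` containing the supports of all earlier `i (Y
  -- l)`. The next row is so large that `p (N (j + 1))` does not divide `i (Y j)` at the new index
  -- `ξ j`.
  let st : ℕ → ℕ × Finset X := fun j => Nat.rec (0, ∅) (fun _ s =>
    (max (s.1 + 1) (m s.1 s.2), s.2 ∪ (i (rowFun s.1 (p s.1 • w s.1 s.2))).support)) j
  let N : ℕ → ℕ := fun j => (st j).1
  let F : ℕ → Finset X := fun j => (st j).2
  let Y : ℕ → ℕ × κ → S := fun j => rowFun (N j) (p (N j) • w (N j) (F j))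
  let ξ : ℕ → X := fun j => x (N j) (F j)
  have hNs : ∀ j, N (j + 1) = max (N j + 1) (m (N j) (F j)) := fun _ => rfl
  have hFs : ∀ j, F (j + 1) = F j ∪ (i (Y j)).support := fun _ => rfl
  have hN : StrictMono N := strictMono_nat_of_lt_succ fun j => by rw [hNs]; omega
  have hF : Monotone F := monotone_nat_of_le_succ fun j => by
    rw [hFs]; exact Finset.subset_union_left
  have hξF : ∀ j, ξ j ∉ F j := fun j => hxF _ _
  have hξ : ∀ j, ¬ p (N (j + 1)) ∣ i (Y j) (ξ j) := fun j h =>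
    hm _ _ ((dvd_of_chain hp (by rw [hNs]; exact le_max_right _ _)).trans h)
  have hsupp : ∀ l j, l < j → (i (Y l)).support ⊆ F j := fun l j h =>
    (show _ ⊆ F (l + 1) by rw [hFs]; exact Finset.subset_union_right).trans (hF h)
  -- The infinite sum of the `Y l`: as `l ≤ N l`, only `l ≤ c.1` contribute at `c`.
  let y : ℕ × κ → S := fun c => ∑ l ∈ Finset.range (c.1 + 1), Y l c
  have htail : ∀ j c, p (N (j + 1)) ∣ (y - ∑ l ∈ Finset.range (j + 1), Y l) c := by
    intro j c
    rw [Pi.sub_apply, Finset.sum_apply]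
    rcases le_total (j + 1) (c.1 + 1) with h | h
    · rw [← Finset.sum_Ico_eq_sub _ h]
      refine Finset.dvd_sum fun l hl => ?_
      change p (N (j + 1)) ∣ if c.1 = N l then _ else _
      split_ifs
      · exact (dvd_of_chain hp (hN.monotone (Finset.mem_Ico.1 hl).1)).trans (dvd_mul_right _ _)
      · exact dvd_zero _
    · have h0 : ∑ l ∈ Finset.Ico (c.1 + 1) (j + 1), Y l c = 0 := by
        refine Finset.sum_eq_zero fun l hl => if_neg ?_
        have h1 := (Finset.mem_Ico.1 hl).1
        have h2 := hN.le_apply (x := l)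
        omega
      rw [Finset.sum_Ico_eq_sub _ h, sub_eq_zero] at h0
      rw [h0, sub_self]
      exact dvd_zero _
  -- At `ξ j` the earlier terms vanish and the tail is divisible by `p (N (j + 1))`, so it cannot
  -- cancel `i (Y j)`. As the `ξ j` are distinct, `i y` would have infinite support.
  have hmem : ∀ j, ξ j ∈ (i y).support := by
    intro j
    rw [Finsupp.mem_support_iff]
    intro h0
    choose v hv using htail j
    have hv' : y = ∑ l ∈ Finset.range j, Y l + Y j + p (N (j + 1)) • v := by
      rw [← Finset.sum_range_succ, ← sub_eq_iff_eq_add']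
      exact funext hv
    rw [hv', map_add, map_add, map_sum, map_smul, Finsupp.add_apply, Finsupp.add_apply,
      Finsupp.finsetSum_apply, Finset.sum_eq_zero, zero_add] at h0
    · refine hξ j ?_
      rw [eq_neg_of_add_eq_zero_left h0]
      exact (dvd_mul_right _ _).neg_right
    · intro l hl
      exact Finsupp.notMem_support_iff.1 fun h => hξF j (hsupp l j (Finset.mem_range.1 hl) h)
  have hinj : Function.Injective ξ := by
    have : ∀ l j, l < j → ξ l ≠ ξ j := fun l j h he => by
      refine hξF j (hsupp l j h (he ▸ Finsupp.mem_support_iff.2 fun h0 => hξ l ?_))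
      rw [h0]
      exact dvd_zero _
    intro l j h
    by_contra hne
    rcases lt_or_gt_of_ne hne with h' | h'
    · exact this l j h' h
    · exact this j l h' h.symm
  exact Set.infinite_of_injective_forall_mem hinj hmem (i y).support.finite_toSet

theorem principalRightIdealDCC_of_projective_pi [Module.Projective S (ℕ × List S → S)] :
    PrincipalRightIdealDCC S := by
  classical
  intro p hp
  by_contra! hneg
  obtain ⟨i, hi⟩ := (Module.projective_def' (R := S) (P := ℕ × List S → S)).1 inferInstance
  obtain ⟨n, F, hF⟩ := exists_row_dvd_of_notMem hp i
  obtain ⟨m, hm⟩ := hneg n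
  let e : Set (List S) → List S → S := fun U => U.indicator 1
  -- Recording finitely many coordinates gives a map from `Set (List S)` to `List S`, hence the
  -- choice of `List S` as index type. For a collision `U`, `V`, all coordinates of the image of the
  -- difference are divisible by `p m`; applying the retraction of `i` contradicts `hm` at any `k`
  -- in just one of the sets.
  refine Function.cantor_injective
    (fun U : Set (List S) => F.toList.map fun x => i (rowFun n (p n • e U)) x) fun U V hUV => ?_
  have hF' : ∀ x ∈ F, i (rowFun n (p n • e U)) x = i (rowFun n (p n • e V)) x := fun x hx =>
    List.map_inj_left.1 hUV x (Finset.mem_toList.2 hx)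
  have hsub : rowFun n (p n • (e U - e V)) = rowFun n (p n • e U) - rowFun n (p n • e V) := by
    funext c
    by_cases h : c.1 = n <;> simp [rowFun, h, mul_sub]
  have hdvd : ∀ x, p m ∣ i (rowFun n (p n • (e U - e V))) x := by
    intro x
    by_cases hx : x ∈ F
    · rw [hsub, map_sub, Finsupp.sub_apply, hF' x hx, sub_self]
      exact dvd_zero _
    · exact hF _ x hx m
  have hk : ∀ k, p m ∣ p n * (e U k - e V k) := by
    intro k
    have h1 := congrFun (DFunLike.congr_fun hi (rowFun n (p n • (e U - e V)))) (n, k)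
    have h2 : rowFun n (p n • (e U - e V)) (n, k) = p n * (e U k - e V k) := by simp [rowFun]
    rw [LinearMap.id_apply, h2, LinearMap.comp_apply, Finsupp.linearCombination_apply, Finsupp.sum,
      Finset.sum_apply] at h1
    rw [← h1]
    exact Finset.dvd_sum fun x _ => (hdvd x).mul_right _
  ext k
  have := hk k
  by_cases hU : k ∈ U <;> by_cases hV : k ∈ V <;> simp [e, hU, hV, hm] at this ⊢

theorem principalRightIdealDCC_of_products {R : Type u} [Ring R] (hR : IsLeftCoherentRing R)
    (H : DingProjectivesClosedUnderProducts R) : PrincipalRightIdealDCC Rᵐᵒᵖ := by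
  have hproj : ∀ I : Type u, Module.Projective Rᵐᵒᵖ (I → R) := fun I =>
    have : Module.Projective Rᵐᵒᵖ R :=
      .of_equiv (MulOpposite.opLinearEquiv Rᵐᵒᵖ : R ≃ₗ[Rᵐᵒᵖ] Rᵐᵒᵖ).symm
    (H I (fun _ => R) fun _ => isDingProjective_of_projective).projective_of_flat
      (hR.relationsTrivial_pi I).isFlatRightModule
  have := hproj (ℕ × List Rᵐᵒᵖ)
  have : Module.Projective Rᵐᵒᵖ (ℕ × List Rᵐᵒᵖ → Rᵐᵒᵖ) :=
    .of_equiv (LinearEquiv.piCongrRight fun _ : ℕ × List Rᵐᵒᵖ =>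
      (MulOpposite.opLinearEquiv Rᵐᵒᵖ : R ≃ₗ[Rᵐᵒᵖ] Rᵐᵒᵖ))
  exact principalRightIdealDCC_of_projective_pi

end Chase

/-! ### T-nilpotency of the Jacobson radical and Nakayama's lemma. -/

section Jacobson

variable {S : Type u} [Ring S]

/-- The left-ideal description gives a left inverse `z` of `1 + x`. Since `z = 1 - z * x` has a left
inverse too, `z` is a two-sided inverse. -/
theorem exists_one_add_mul_eq_one_of_mem_jacobson {x : S} (hx : x ∈ Ring.jacobson S) :
    ∃ y, (1 + x) * y = 1 := by
  have left : ∀ x ∈ Ring.jacobson S, ∃ z, z * (x + 1) = 1 := fun x hx => by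
    obtain ⟨z, hz⟩ := Ideal.exists_mul_add_sub_mem_of_mem_jacobson (I := ⊥) x
      (by rwa [Ideal.jacobson_bot])
    exact ⟨z, sub_eq_zero.1 ((Submodule.mem_bot S).1 hz)⟩
  obtain ⟨z, hz⟩ := left x hx
  obtain ⟨w, hw⟩ := left (-(z * x)) (neg_mem (Ideal.mul_mem_left _ _ hx))
  have hzx : -(z * x) + 1 = z := by rw [← hz]; noncomm_ring
  rw [hzx] at hw
  have : w = x + 1 := left_inv_eq_right_inv hw hz
  exact ⟨z, by rw [add_comm, ← this, hw]⟩

theorem jacobson_mulOpposite_eq_bot (h : Ring.jacobson S = ⊥) : Ring.jacobson Sᵐᵒᵖ = ⊥ := by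
  refine eq_bot_iff.2 fun x hx => ?_
  have hx' : x.unop ∈ Ring.jacobson S := by
    rw [← Ideal.jacobson_bot, Ideal.mem_jacobson_iff]
    intro y
    obtain ⟨w, hw⟩ := exists_one_add_mul_eq_one_of_mem_jacobson
      (Ideal.mul_mem_left _ (MulOpposite.op y) hx)
    have hw' : w.unop * (1 + x.unop * y) = 1 := by simpa using congrArg MulOpposite.unop hw
    refine ⟨1 - y * w.unop * x.unop, (Submodule.mem_bot S).2 ?_⟩
    calc _ = y * x.unop - y * (w.unop * (1 + x.unop * y)) * x.unop := by noncomm_ring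
      _ = 0 := by rw [hw']; noncomm_ring
  rw [h, Submodule.mem_bot] at hx'
  exact (Submodule.mem_bot _).2 (MulOpposite.unop_injective hx')

/-- If the product `b` of the first `n` terms equals `b * a n * s`, then `b * (1 - a n * s) = 0`
with a right invertible second factor. -/
theorem PrincipalRightIdealDCC.exists_mulSeq_eq_zero (H : PrincipalRightIdealDCC S) (a : ℕ → S)
    (ha : ∀ n, a n ∈ Ring.jacobson S) : ∃ n, mulSeq a 0 n = 0 := by
  obtain ⟨n, hn⟩ := H (mulSeq a 0) fun n => ⟨a n, by simp [mulSeq]⟩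
  obtain ⟨s, hs⟩ := hn (n + 1)
  obtain ⟨y, hy⟩ := exists_one_add_mul_eq_one_of_mem_jacobson
    (neg_mem (Ideal.mul_mem_right s _ (ha n)))
  refine ⟨n, ?_⟩
  have h0 : mulSeq a 0 n * (1 + -(a n * s)) = 0 := by
    conv_lhs => rw [mul_add, mul_one, mul_neg, ← mul_assoc]
    rw [mulSeq, zero_add] at hs
    rw [← hs, add_neg_cancel]
  rw [← mul_one (mulSeq a 0 n), ← hy, ← mul_assoc, h0, zero_mul]

theorem PrincipalRightIdealDCC.isNilpotent_of_mem_jacobson (H : PrincipalRightIdealDCC S) {x : S}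
    (hx : x ∈ Ring.jacobson S) : IsNilpotent x := by
  obtain ⟨n, hn⟩ := H.exists_mulSeq_eq_zero (fun _ => x) fun _ => hx
  refine ⟨n, ?_⟩
  rw [← hn]
  clear hn
  induction n with
  | zero => simp [mulSeq]
  | succ n ih => rw [pow_succ, ih, mulSeq]

variable {M : Type u} [AddCommGroup M] [Module S M]

/-- Nakayama's lemma for a T-nilpotent Jacobson radical, without finiteness. -/
theorem PrincipalRightIdealDCC.subsingleton_of_jacobson_smul_eq_top (H : PrincipalRightIdealDCC S)
    (hM : Ring.jacobson S • (⊤ : Submodule S M) = ⊤) : Subsingleton M := by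
  refine subsingleton_of_forall_eq 0 fun x₀ => ?_
  by_contra hx₀
  -- Expanding `x` in `JM` shows that a nonzero `b • x` yields a nonzero `(b * a) • x'` with `a` in
  -- the radical. Iteration gives products that never vanish, against T-nilpotency.
  have step : ∀ c : {c : S × M // c.1 • c.2 ≠ 0}, ∃ a ∈ Ring.jacobson S, ∃ x : M,
      (c.1.1 * a) • x ≠ 0 := by
    rintro ⟨⟨b, x⟩, hc⟩
    by_contra! hne
    refine hc ?_
    have hx : x ∈ Ring.jacobson S • (⊤ : Submodule S M) := by
      rw [hM]; exact Submodule.mem_top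
    refine Submodule.smul_induction_on (p := fun x => b • x = 0) hx (fun a ha y _ => ?_)
      fun y z hy hz => ?_
    · rw [← mul_smul, hne a ha y]
    · rw [smul_add, hy, hz, add_zero]
  choose a ha x hx using step
  let st : ℕ → {c : S × M // c.1 • c.2 ≠ 0} := fun n =>
    Nat.rec ⟨(1, x₀), by simpa using hx₀⟩ (fun _ c => ⟨(c.1.1 * a c, x c), hx c⟩) n
  obtain ⟨n, hn⟩ := H.exists_mulSeq_eq_zero (fun n => a (st n)) fun n => ha _
  have hst : (st n).1.1 = mulSeq (fun n => a (st n)) 0 n := by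
    have := eq_mul_mulSeq (p := fun n => (st n).1.1) (a := fun n => a (st n)) (fun n => rfl) 0 n
    rw [zero_add] at this
    rw [this]
    exact one_mul _
  refine (st n).2 ?_
  rw [hst, hn, zero_smul]

theorem PrincipalRightIdealDCC.eq_top_of_sup_jacobson_smul_eq_top (H : PrincipalRightIdealDCC S)
    {N : Submodule S M} (hN : N ⊔ Ring.jacobson S • ⊤ = ⊤) : N = ⊤ := by
  refine Submodule.Quotient.subsingleton_iff.1
    (H.subsingleton_of_jacobson_smul_eq_top (eq_top_iff.2 fun z _ => ?_))
  obtain ⟨x, rfl⟩ := N.mkQ_surjective z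
  obtain ⟨y, hy, w, hw, rfl⟩ := Submodule.mem_sup.1 (hN ▸ Submodule.mem_top : x ∈ N ⊔ _)
  rw [map_add, (Submodule.Quotient.mk_eq_zero N).2 hy |> fun h => (h : N.mkQ y = 0), zero_add]
  have := Submodule.mem_map_of_mem (f := N.mkQ) hw
  rw [Submodule.map_smul''] at this
  exact Submodule.smul_mono le_rfl le_top this

end Jacobson

/-! ### Semisimplicity of the ring modulo its radical. -/

section Semisimple

theorem exists_eq_span_singleton_of_isCompl {T : Type u} [Ring T] {I N : Ideal T}
    (h : IsCompl N I) : ∃ a, I = Ideal.span {a} := by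
  obtain ⟨u, hu, v, hv, huv⟩ := Submodule.mem_sup.1
    (h.sup_eq_top ▸ Submodule.mem_top : (1 : T) ∈ N ⊔ I)
  refine ⟨v, le_antisymm (fun x hx => ?_) ((Ideal.span_singleton_le_iff_mem I).2 hv)⟩
  have h1 : x * u = x - x * v := by rw [eq_sub_iff_add_eq, ← mul_add, huv, mul_one]
  have h2 : x * u ∈ N ⊓ I :=
    ⟨N.mul_mem_left _ hu, h1 ▸ I.sub_mem hx (I.mul_mem_left _ hv)⟩
  rw [h.inf_eq_bot, Submodule.mem_bot, h1, sub_eq_zero] at h2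
  exact Ideal.mem_span_singleton'.2 ⟨x, h2.symm⟩

/-- A semiprimitive ring with the descending chain condition on principal left ideals is
semisimple. -/
theorem isSemisimpleRing_of_wellFounded {T : Type u} [Ring T] (hJ : Ring.jacobson T = ⊥)
    (hwf : WellFounded fun a b : T => Ideal.span {a} < Ideal.span {b}) : IsSemisimpleRing T := by
  have hatom : ∀ I : Ideal T, I ≠ ⊥ → ∃ K : Ideal T, IsAtom K ∧ K ≤ I := by
    intro I hI
    obtain ⟨b, hbI, hb⟩ := Submodule.exists_mem_ne_zero_of_ne_bot hI
    obtain ⟨a, ⟨haI, ha⟩, hmin⟩ := hwf.has_min {a | a ∈ I ∧ a ≠ 0} ⟨b, hbI, hb⟩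
    have hle : Ideal.span {a} ≤ I := (Ideal.span_singleton_le_iff_mem I).2 haI
    refine ⟨Ideal.span {a}, ⟨by simpa using ha, fun B hB => ?_⟩, hle⟩
    by_contra hne
    obtain ⟨c, hcB, hc⟩ := Submodule.exists_mem_ne_zero_of_ne_bot hne
    exact hmin c ⟨hle (hB.le hcB), hc⟩
      (lt_of_le_of_lt ((Ideal.span_singleton_le_iff_mem B).2 hcB) hB)
  -- Choose a minimal principal left ideal with a semisimple complement. If it is nonzero, an atom
  -- `K` inside it splits off, because zero radical provides a maximal `m` not containing `K`, and
  -- the remainder is again principal.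
  obtain ⟨a, ⟨N, hN, hNa⟩, hmin⟩ := hwf.has_min
    {a | ∃ N : Ideal T, IsSemisimpleModule T N ∧ IsCompl N (Ideal.span {a})}
    ⟨1, ⊥, IsSemisimpleModule.of_sSup_simples_eq_top (Subsingleton.elim _ _),
      by rw [Ideal.span_singleton_one]; exact isCompl_bot_top⟩
  by_cases ha : Ideal.span {a} = ⊥
  · rw [ha] at hNa
    have hN' : N = ⊤ := by simpa using hNa.sup_eq_top
    subst hN'
    exact (Submodule.topEquiv : (⊤ : Ideal T) ≃ₗ[T] T).isSemisimpleModule_iff.1 hN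
  exfalso
  obtain ⟨K, hK, hKa⟩ := hatom _ ha
  obtain ⟨m, hm, hKm⟩ : ∃ m : Ideal T, IsCoatom m ∧ ¬ K ≤ m := by
    by_contra! hle
    refine hK.1 (eq_bot_iff.2 ?_)
    rw [← hJ]
    exact le_sInf fun m hm => hle m hm
  have hKm' : K ⊓ m = ⊥ := (hK.le_iff.1 inf_le_left).resolve_right fun h => hKm (inf_eq_left.1 h)
  have hKm'' : K ⊔ m = ⊤ := (hm.le_iff.1 le_sup_right).resolve_right fun h => hKm (sup_eq_right.1 h)
  have hcompl : IsCompl (N ⊔ K) (m ⊓ Ideal.span {a}) := by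
    refine IsCompl.of_eq ?_ ?_
    · rw [inf_comm m, ← inf_assoc, sup_comm, sup_inf_assoc_of_le _ hKa, hNa.inf_eq_bot, sup_bot_eq,
        hKm']
    · rw [sup_assoc, ← sup_inf_assoc_of_le _ hKa, hKm'', top_inf_eq, hNa.sup_eq_top]
  obtain ⟨b, hb⟩ := exists_eq_span_singleton_of_isCompl hcompl
  have : IsSimpleModule T K := isSimpleModule_iff_isAtom.2 hK
  refine hmin b ⟨N ⊔ K, IsSemisimpleModule.sup hN inferInstance, hb ▸ hcompl⟩ ?_
  rw [← hb]
  refine lt_of_le_of_ne inf_le_right fun h => hKm ?_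
  exact hKa.trans (h ▸ inf_le_left)

theorem PrincipalRightIdealDCC.isSemisimpleRing_quotient_jacobson {S : Type u} [Ring S]
    (H : PrincipalRightIdealDCC S) : IsSemisimpleRing (S ⧸ Ring.jacobson S) := by
  have : IsSemisimpleRing (S ⧸ Ring.jacobson S)ᵐᵒᵖ := by
    refine isSemisimpleRing_of_wellFounded
      (jacobson_mulOpposite_eq_bot (Ring.jacobson_quotient_jacobson S)) ?_
    refine wellFounded_iff_isEmpty_descending_chain.2 ⟨fun ⟨p, hp⟩ => ?_⟩
    choose c hc using fun n => Ideal.mem_span_singleton'.1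
      ((Ideal.span_singleton_le_iff_mem _).1 (hp n).le)
    choose c' hc' using fun n => Ideal.Quotient.mk_surjective (c n).unop
    obtain ⟨q₀, hq₀⟩ := Ideal.Quotient.mk_surjective (p 0).unop
    -- Lifting only the first generator and the successive multipliers makes `q` a genuine
    -- divisibility chain in `S`.
    let q : ℕ → S := fun n => q₀ * mulSeq c' 0 n
    have hqs : ∀ n, q (n + 1) = q n * c' n := fun n => by simp [q, mulSeq, mul_assoc]
    have hq : ∀ n, Ideal.Quotient.mk (Ring.jacobson S) (q n) = (p n).unop := by
      intro n
      induction n with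
      | zero => simpa [q, mulSeq] using hq₀
      | succ n ih => rw [hqs, map_mul, ih, hc', ← MulOpposite.unop_mul, hc]
    obtain ⟨n, hn⟩ := H q fun n => ⟨c' n, hqs n⟩
    obtain ⟨s, hs⟩ := hn (n + 1)
    refine (hp n).not_ge ((Ideal.span_singleton_le_iff_mem _).2 (Ideal.mem_span_singleton'.2
      ⟨MulOpposite.op (Ideal.Quotient.mk _ s), MulOpposite.unop_injective ?_⟩))
    rw [MulOpposite.unop_mul, MulOpposite.unop_op, ← hq, ← hq, ← map_mul, ← hs]
  exact (RingEquiv.opOp (S ⧸ Ring.jacobson S)).symm.isSemisimpleRing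

end Semisimple

/-! ### Construction of projective covers. -/

section ProjectiveCover

variable {S : Type u} [Ring S]

theorem PrincipalRightIdealDCC.isSemisimpleModule_quotient_jacobson
    (H : PrincipalRightIdealDCC S) : IsSemisimpleModule S (S ⧸ Ring.jacobson S) := by
  let l : (S ⧸ Ring.jacobson S) →ₛₗ[Ideal.Quotient.mk (Ring.jacobson S)] (S ⧸ Ring.jacobson S) :=
    { toFun := id
      map_add' := fun _ _ => rfl
      map_smul' := fun s x => by
        obtain ⟨x, rfl⟩ := Ideal.Quotient.mk_surjective x
        rfl }
  have : RingHomSurjective (Ideal.Quotient.mk (Ring.jacobson S)) := ⟨Ideal.Quotient.mk_surjective⟩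
  exact (LinearMap.isSemisimpleModule_iff_of_bijective l Function.bijective_id).2
    H.isSemisimpleRing_quotient_jacobson

/-- A projective presentation with kernel inside the radical. -/
theorem PrincipalRightIdealDCC.exists_radical_presentation_of_isSimpleModule
    (H : PrincipalRightIdealDCC S) (T : Type u) [AddCommGroup T] [Module S T] [IsSimpleModule S T] :
    ∃ (P : Type u) (_ : AddCommGroup P) (_ : Module S P) (p : P →ₗ[S] T),
      Module.Projective S P ∧ Function.Surjective p ∧
        LinearMap.ker p ≤ Ring.jacobson S • (⊤ : Submodule S P) := by
  have := H.isSemisimpleModule_quotient_jacobson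
  have := IsSimpleModule.nontrivial S T
  obtain ⟨t, ht⟩ := exists_ne (0 : T)
  let J := Ring.jacobson S
  let π : (S ⧸ J) →ₗ[S] T := J.liftQ (LinearMap.toSpanSingleton S T t) <| by
    have := IsSimpleModule.ker_toSpanSingleton_isMaximal S ht
    exact Ring.jacobson_le_of_isMaximal _
  have hπ : Function.Surjective π := fun y => by
    obtain ⟨s, rfl⟩ := IsSimpleModule.toSpanSingleton_surjective S ht y
    exact ⟨J.mkQ s, rfl⟩
  obtain ⟨σ, hσ⟩ := IsSemisimpleModule.lifting_property π hπ LinearMap.id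
  have hσ' : ∀ x, π (σ x) = x := DFunLike.congr_fun hσ
  let mk := Ideal.Quotient.mk J
  -- The splitting makes `σ ∘ π` right multiplication by the idempotent `ε`. It lifts to an
  -- idempotent `e` since `J` is nil, and `Se` is the desired projective.
  let ε : S ⧸ J := σ (π 1)
  have hε : ∀ s : S, σ (π (mk s)) = mk s * ε := fun s => by
    have h1 : mk s = s • (1 : S ⧸ J) := by
      change mk s = mk (s • 1)
      rw [smul_eq_mul, mul_one]
    have h2 : ∀ x : S ⧸ J, s • x = mk s * x := fun x => by
      obtain ⟨x, rfl⟩ := Ideal.Quotient.mk_surjective x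
      rfl
    conv_lhs => rw [h1, map_smul, map_smul]
    exact h2 _
  obtain ⟨s₀, hs₀⟩ := Ideal.Quotient.mk_surjective ε
  have hidem : IsIdempotentElem ε := by
    have h1 := hε s₀
    change mk s₀ = ε at hs₀
    rw [hs₀] at h1
    rw [IsIdempotentElem, ← h1]
    change σ (π (σ (π 1))) = _
    rw [hσ']
  obtain ⟨e, he, hmke⟩ := exists_isIdempotentElem_eq_of_ker_isNilpotent mk
    (fun x hx => H.isNilpotent_of_mem_jacobson (by rwa [Ideal.mk_ker] at hx)) ε ⟨s₀, hs₀⟩ hidem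
  let ρ : S →ₗ[S] S := LinearMap.toSpanSingleton S S e
  have hρ : ∀ y : LinearMap.range ρ, y.1 * e = y.1 := by
    rintro ⟨_, x, rfl⟩
    change x * e * e = x * e
    rw [mul_assoc, he.eq]
  refine ⟨LinearMap.range ρ, inferInstance, inferInstance, π ∘ₗ J.mkQ ∘ₗ Submodule.subtype _,
    ?_, fun y => ?_, fun y hy => ?_⟩
  · exact Module.Projective.of_split (LinearMap.range ρ).subtype ρ.rangeRestrict
      (LinearMap.ext fun y => Subtype.ext (hρ y))
  · obtain ⟨x, rfl⟩ := hπ y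
    obtain ⟨s, rfl⟩ := Ideal.Quotient.mk_surjective x
    refine ⟨⟨ρ s, s, rfl⟩, ?_⟩
    change π (mk (s * e)) = π (mk s)
    rw [map_mul, hmke, ← hε, hσ']
  · have h0 : π (mk y.1) = 0 := hy
    have h1 := hε y.1
    rw [h0, map_zero, ← hmke, ← map_mul, hρ] at h1
    have h2 : y.1 ∈ J := Ideal.Quotient.eq_zero_iff_mem.1 h1.symm
    have h3 : y = y.1 • ⟨ρ 1, 1, rfl⟩ := Subtype.ext <| by
      change y.1 = y.1 * (1 * e)
      rw [one_mul, hρ]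
    rw [h3]
    exact Submodule.smul_mem_smul h2 Submodule.mem_top

/-- Each element of `M ⧸ JM` lies in the image of a map from the semisimple module `S ⧸ J`. -/
theorem PrincipalRightIdealDCC.isSemisimpleModule_quotient_jacobson_smul
    (H : PrincipalRightIdealDCC S) (M : Type u) [AddCommGroup M] [Module S M] :
    IsSemisimpleModule S (M ⧸ Ring.jacobson S • (⊤ : Submodule S M)) := by
  have := H.isSemisimpleModule_quotient_jacobson
  let N := Ring.jacobson S • (⊤ : Submodule S M)
  let π : M → (S ⧸ Ring.jacobson S) →ₗ[S] M ⧸ N := fun m =>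
    (Ring.jacobson S).liftQ (N.mkQ ∘ₗ LinearMap.toSpanSingleton S M m) fun a ha => by
      refine (Submodule.Quotient.mk_eq_zero N).2 ?_
      exact Submodule.smul_mem_smul ha Submodule.mem_top
  refine isSemisimpleModule_of_isSemisimpleModule_submodule' (p := fun m => LinearMap.range (π m))
    (fun m => .range _) (eq_top_iff.2 fun x _ => ?_)
  obtain ⟨m, rfl⟩ := N.mkQ_surjective x
  refine Submodule.mem_iSup_of_mem m ⟨(Ring.jacobson S).mkQ 1, ?_⟩
  change N.mkQ ((1 : S) • m) = N.mkQ m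
  rw [one_smul]

theorem PrincipalRightIdealDCC.exists_radical_presentation_of_isSemisimpleModule
    (H : PrincipalRightIdealDCC S) (M : Type u) [AddCommGroup M] [Module S M]
    [IsSemisimpleModule S M] :
    ∃ (P : Type u) (_ : AddCommGroup P) (_ : Module S P) (p : P →ₗ[S] M),
      Module.Projective S P ∧ Function.Surjective p ∧
        LinearMap.ker p ≤ Ring.jacobson S • (⊤ : Submodule S P) := by
  classical
  obtain ⟨s, e, -, hs⟩ := IsSemisimpleModule.exists_linearEquiv_dfinsupp S M
  choose P _ _ p hP hp hker using fun m : s =>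
    H.exists_radical_presentation_of_isSimpleModule m.1
  refine ⟨Π₀ m, P m, inferInstance, inferInstance,
    e.symm.toLinearMap ∘ₗ DFinsupp.mapRange.linearMap p, inferInstance,
    e.symm.surjective.comp ((DFinsupp.mapRange_surjective _ fun m => map_zero (p m)).2 hp),
    fun x hx => ?_⟩
  have h0 : DFinsupp.mapRange.linearMap p x = 0 := e.symm.injective (by rw [map_zero]; exact hx)
  rw [← DFinsupp.sum_single (f := x)]
  refine Submodule.sum_mem _ fun m _ => ?_
  have h1 : x m ∈ Ring.jacobson S • (⊤ : Submodule S (P m)) := hker m (DFunLike.congr_fun h0 m)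
  have h2 := Submodule.mem_map_of_mem (f := DFinsupp.lsingle (R := S) m) h1
  rw [Submodule.map_smul''] at h2
  exact Submodule.smul_mono le_rfl le_top h2

/-- Bass: over a ring with the descending chain condition on principal right ideals, all left
modules have projective covers. -/
theorem PrincipalRightIdealDCC.exists_isProjectiveCover (H : PrincipalRightIdealDCC S) (M : Type u)
    [AddCommGroup M] [Module S M] :
    ∃ (P : Type u) (_ : AddCommGroup P) (_ : Module S P) (p : P →ₗ[S] M), IsProjectiveCover p := by
  have := H.isSemisimpleModule_quotient_jacobson_smul M
  let N := Ring.jacobson S • (⊤ : Submodule S M)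
  obtain ⟨P, _, _, p, hP, hp, hker⟩ := H.exists_radical_presentation_of_isSemisimpleModule (M ⧸ N)
  -- Nakayama is used twice on the lift `q`: its range together with `JM` is all of `M`, and its
  -- kernel lies in the superfluous submodule `JP`.
  obtain ⟨q, hq⟩ := Module.projective_lifting_property N.mkQ p N.mkQ_surjective
  refine ⟨P, inferInstance, inferInstance, q, hP, ?_, fun L hL => ?_⟩
  · refine LinearMap.range_eq_top.1 (H.eq_top_of_sup_jacobson_smul_eq_top (eq_top_iff.2 ?_))
    intro m _
    obtain ⟨x, hx⟩ := hp (N.mkQ m)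
    have h1 : m - q x ∈ N := by
      rw [← Submodule.ker_mkQ N, LinearMap.mem_ker, map_sub, ← hx, ← hq]
      exact sub_self _
    exact Submodule.mem_sup.2 ⟨q x, ⟨x, rfl⟩, m - q x, h1, add_sub_cancel _ _⟩
  · refine H.eq_top_of_sup_jacobson_smul_eq_top (top_le_iff.1 (hL.ge.trans (sup_le_sup_left ?_ L)))
    intro x hx
    refine hker ?_
    rw [LinearMap.mem_ker, ← hq, LinearMap.comp_apply, LinearMap.mem_ker.1 hx, map_zero]

end ProjectiveCover

theorem mainTheorem11 (R : Type u) [Ring R] :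
    (DingProjectivesClosedUnderDirectLimits R → IsRightPerfectRing R) ∧
    (IsLeftCoherentRing R → DingProjectivesClosedUnderProducts R → IsRightPerfectRing R) :=
  ⟨fun H M _ _ => (principalRightIdealDCC_of_directLimits H).exists_isProjectiveCover M,
    fun hR H M _ _ => (principalRightIdealDCC_of_products hR H).exists_isProjectiveCover M⟩
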